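/- Let $\beta\omega$ be the space of ultrafilters on the discrete space $\omega$, with $\omega\subseteq\beta\omega$ the set of principal ultrafilters. Every $f:\omega\to\beta\omega$ extends uniquely to a continuous map $\widetilde f:\beta\omega\to\beta\omega$. For $\mathfrak u,\mathfrak v\in\beta\omega$ put $\mathfrak u\le_{\mathrm{RK}}\mathfrak v$ if $\widetilde f(\mathfrak v)=\mathfrak u$ for some $f:\omega\to\omega$. The type $\tau(\mathfrak u)$ is the class of $\mathfrak u$ under the equivalence relation $\le_{\mathrm{RK}}\cap\le_{\mathrm{RK}}^{-1}$; $\le_{\mathrm{RK}}$ induces a partial order on types. Let $\mathrm{DF}$ be the set of injective functions $f:\omega\to\beta\omega$ with discrete range. For a non-principal $\mathfrak u\in\beta\omega$ define by recursion on ordinals $W_0(\mathfrak u)=\omega$, $W_{<\alpha}(\mathfrak u)=\bigcup_{\beta<\alpha}W_\beta(\mathfrak u)$ and, for $\alpha>0$, let $W_\alpha(\mathfrak u)$ be the set of all ultrafilters $\widetilde f(\mathfrak u)$ with $f\in\mathrm{DF}$ such that $\{i<\omega: f(i)\in W_{<\alpha}(\mathfrak u)\setminus W_{<\beta}(\mathfrak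 u)\}\in\mathfrak u$ for all $\beta<\alpha$. Put $W^\tau_{<\alpha}(\mathfrak u)=\{\tau(\mathfrak v):\mathfrak v\in W_{<\alpha}(\mathfrak u)\}$. For a map $e:A\to B$ let $e^{\mathfrak u}:\prod_{\mathfrak u}A\to\prod_{\mathfrak u}B$ be the map $[g]_{\mathfrak u}\mapsto[e\circ g]_{\mathfrak u}$ of ultrapowers. For an ordered set $\mathfrak M$, the skew ultralimits $\mathfrak M_{\mathfrak u,\alpha}$ and the commuting embeddings $e_{\beta\gamma}:\mathfrak M_{\mathfrak u,\beta}\to\mathfrak M_{\mathfrak u,\gamma}$ ($\beta\le\gamma$, $e_{\beta\beta}=\mathrm{id}$) are given by recursion: $\mathfrak M_{\mathfrak u,0}=\mathfrak M$; $\mathfrak M_{\mathfrak u,\beta+1}=\prod_{\mathfrak u}\mathfrak M_{\mathfrak u,\beta}$; $e_{01}$ is the diagonal embedding; $e_{\delta+1,\beta+1}=e_{\delta\beta}^{\mathfrak u}$ for $\delta\le\beta$; and for a limit ordinal $\gamma$, $\mathfrak M_{\mathfrak u,\gamma}$ with the maps $e_{\beta\gamma}$ ($\beta<\gamma$) is the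 direct limit of the preceding stages. (The maps $e_{\gamma,\beta+1}$ with $\gamma=0$ or $\gamma$ a limit are determined by these conditions.) Theorem. For every non-principal ultrafilter $\mathfrak u\in\beta\omega$ and every ordinal $\alpha$, the poset $(W^\tau_{<\omega+\alpha}(\mathfrak u),\le_{\mathrm{RK}})$ is isomorphic to the skew ultralimit $\mathfrak M_{\mathfrak u,\alpha}$ of $\mathfrak M=(\omega,\le)$ with the standard order. -/

import Mathlib

universe v w

namespace SkewUL

open Filter

/-! ### Skew ultralimits -/

/-- A direct system, indexed by the ordinals, of order embeddings between the successive skew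
ultralimits `Carrier α` of the ordered set `M` with respect to the ultrafilter `a`:
* `Carrier 0` is `M`;
* `Carrier (α + 1)` is the ultrapower `∏_a Carrier α` (`Germ a (Carrier α)`);
* the embedding `Carrier 0 → Carrier 1` is the diagonal embedding `d`;
* for `δ ≤ β` the embedding `Carrier (δ + 1) → Carrier (β + 1)` is `e_{δβ}^a`, where
  `e_{δβ} : Carrier δ → Carrier β` (and not a diagonal embedding);
* at a limit ordinal, `Carrier α` is the direct limit of the earlier stages (for a system of
  embeddings: each of its elements comes from an earlier stage).
The embeddings out of `Carrier 0` and out of limit stages are determined by `emb_trans`. -/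
structure SkewSystem {ι : Type} (a : Ultrafilter ι) (M : Type w) [LE M] where
  Carrier : Ordinal.{v} → Type w
  le : ∀ α, LE (Carrier α)
  emb : ∀ {β γ : Ordinal.{v}}, β ≤ γ → (Carrier β ↪o Carrier γ)
  emb_refl : ∀ (β : Ordinal.{v}) (x : Carrier β), emb (le_refl β) x = x
  emb_trans : ∀ {β γ δ : Ordinal.{v}} (h₁ : β ≤ γ) (h₂ : γ ≤ δ) (x : Carrier β),
    emb h₂ (emb h₁ x) = emb (h₁.trans h₂) x
  zeroIso : Carrier 0 ≃o M
  succIso : ∀ β : Ordinal.{v}, Carrier (Order.succ β) ≃o Germ (a : Filter ι) (Carrier β)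
  succIso_emb_zero : ∀ x : Carrier 0,
    succIso 0 (emb (Order.le_succ 0) x) = ((x : Carrier 0) : Germ (a : Filter ι) (Carrier 0))
  succIso_emb_succ : ∀ {δ β : Ordinal.{v}} (h : δ ≤ β) (x : Carrier (Order.succ δ)),
    succIso β (emb (Order.succ_le_succ h) x) = (succIso δ x).map (emb h)
  exists_of_limit : ∀ {γ : Ordinal.{v}}, Order.IsSuccLimit γ → ∀ x : Carrier γ,
    ∃ (β : Ordinal.{v}) (h : β < γ) (y : Carrier β), emb h.le y = x

/-- Names of elements of skew ultralimits: `leaf m` names `m ∈ M`, and `node g` names the class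
modulo the ultrafilter of the function whose value at `i` is named by `g i`. -/
inductive Tree (ι : Type) (M : Type w) : Type w
  | leaf : M → Tree ι M
  | node : (ι → Tree ι M) → Tree ι M

namespace Tree

variable {ι : Type} {M : Type w}

/-- The sequence of names that a name stands for (constant for a leaf: diagonal embedding). -/
def branch : Tree ι M → ι → Tree ι M
  | leaf m, _ => leaf m
  | node g, i => g i

/-- `Stage α t`: the name `t` names an element of the stage `α`. -/
inductive Stage : Ordinal.{v} → Tree ι M → Prop
  | leaf (α : Ordinal.{v}) (m : M) : Stage α (Tree.leaf m)
  | node (α β : Ordinal.{v}) (h : β < α) (g : ι → Tree ι M) (hg : ∀ i, Stage β (g i)) :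
      Stage α (Tree.node g)

/-- Auxiliary to `Lift`: the case in which the first name is a leaf. -/
def LiftLeaf (a : Ultrafilter ι) (r : M → M → Prop) (m : M) : Tree ι M → Prop
  | leaf n => r m n
  | node h => ∀ᶠ i in (a : Filter ι), LiftLeaf a r m (h i)

/-- The relation between names that a relation on `M` induces in the iterated ultrapowers. -/
def Lift (a : Ultrafilter ι) (r : M → M → Prop) : Tree ι M → Tree ι M → Prop
  | leaf m, t => LiftLeaf a r m t
  | node g, t => ∀ᶠ i in (a : Filter ι), Lift a r (g i) (t.branch i)

theorem lift_iff (a : Ultrafilter ι) (r : M → M → Prop) (s t : Tree ι M) :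
    Lift a r s t ↔ ∀ᶠ i in (a : Filter ι), Lift a r (s.branch i) (t.branch i) := by
  cases s with
  | node g => rfl
  | leaf m =>
    cases t with
    | node h => rfl
    | leaf n => simp [branch]

theorem lift_refl (a : Ultrafilter ι) (t : Tree ι M) : Lift a Eq t t := by
  induction t with
  | leaf m => exact rfl
  | node g ih => exact Eventually.of_forall ih

theorem lift_comp (a : Ultrafilter ι) {p q r : M → M → Prop}
    (H : ∀ x y z, p x y → q y z → r x z) (s t v : Tree ι M) :
    Lift a p s t → Lift a q t v → Lift a r s v := by
  induction s generalizing t v with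
  | node g ih =>
    intro h₁ h₂
    rw [lift_iff] at h₁ h₂ ⊢
    filter_upwards [h₁, h₂] with i k₁ k₂ using ih i _ _ k₁ k₂
  | leaf m =>
    induction t generalizing v with
    | node g ih =>
      intro h₁ h₂
      rw [lift_iff] at h₁ h₂ ⊢
      filter_upwards [h₁, h₂] with i k₁ k₂ using ih i _ k₁ k₂
    | leaf n =>
      induction v with
      | node g ih =>
        intro h₁ h₂
        rw [lift_iff] at h₁ h₂ ⊢
        filter_upwards [h₁, h₂] with i k₁ k₂ using ih i k₁ k₂
      | leaf k => exact H m n k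

theorem lift_symm (a : Ultrafilter ι) (s t : Tree ι M) : Lift a Eq s t → Lift a Eq t s := by
  induction s generalizing t with
  | node g ih =>
    intro h
    rw [lift_iff] at h ⊢
    filter_upwards [h] with i k using ih i _ k
  | leaf m =>
    induction t with
    | node g ih =>
      intro h
      rw [lift_iff] at h ⊢
      filter_upwards [h] with i k using ih i k
    | leaf n => exact Eq.symm

theorem Stage.mono {β γ : Ordinal.{v}} (h : β ≤ γ) {t : Tree ι M} (ht : Stage β t) :
    Stage γ t := by
  cases ht with
  | leaf _ m => exact .leaf _ m
  | node _ δ hδ g hg => exact .node _ δ (hδ.trans_le h) g hg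

theorem Stage.branch {β : Ordinal.{v}} {t : Tree ι M} (ht : Stage (Order.succ β) t) (i : ι) :
    Stage β (t.branch i) := by
  cases ht with
  | leaf _ m => exact .leaf _ m
  | node _ δ hδ g hg => exact (hg i).mono (Order.lt_succ_iff.1 hδ)

/-- Equality of the elements named by two names of stage `α`. -/
def stageSetoid (a : Ultrafilter ι) (M : Type w) (α : Ordinal.{v}) :
    Setoid {t : Tree ι M // Stage α t} where
  r s t := Lift a Eq s.1 t.1
  iseqv :=
    { refl := fun t => lift_refl a t.1
      symm := fun {s t} h => lift_symm a s.1 t.1 h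
      trans := fun {s t v} h₁ h₂ =>
        lift_comp a (p := Eq) (q := Eq) (fun _ _ _ => Eq.trans) s.1 t.1 v.1 h₁ h₂ }

theorem lift_congr (a : Ultrafilter ι) (r : M → M → Prop) {s t s' t' : Tree ι M}
    (hs : Lift a Eq s s') (ht : Lift a Eq t t') (h : Lift a r s t) : Lift a r s' t' :=
  lift_comp a (p := r) (q := Eq) (fun _ _ _ h₁ h₂ => h₂ ▸ h₁) s' t t'
    (lift_comp a (p := Eq) (q := r) (fun _ _ _ h₁ h₂ => h₁ ▸ h₂) s' s t (lift_symm a s s' hs) h) ht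

end Tree

/-- The elements named at stage `α`: the names of stage `α`, modulo equality. -/
def StageClass {ι : Type} (a : Ultrafilter ι) (M : Type w) (α : Ordinal.{v}) : Type w :=
  Quotient (Tree.stageSetoid a M α)

namespace StageClass

variable {ι : Type} {a : Ultrafilter ι} {M : Type w}

/-- The element with a given name. -/
def mk (a : Ultrafilter ι) {α : Ordinal.{v}} (t : Tree ι M) (ht : Tree.Stage α t) :
    StageClass a M α :=
  Quotient.mk (Tree.stageSetoid a M α) ⟨t, ht⟩

theorem mk_eq {α : Ordinal.{v}} {s t : Tree ι M} {hs : Tree.Stage α s} {ht : Tree.Stage α t} :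
    mk a s hs = mk a t ht ↔ Tree.Lift a Eq s t :=
  ⟨fun h => Quotient.exact h, fun h => Quotient.sound h⟩

theorem exists_mk {α : Ordinal.{v}} (x : StageClass a M α) : ∃ t ht, mk a t ht = x := by
  obtain ⟨t, rfl⟩ := Quotient.exists_rep x
  exact ⟨t.1, t.2, rfl⟩

instance [LE M] (α : Ordinal.{v}) : LE (StageClass a M α) where
  le := Quotient.lift₂ (fun s t => Tree.Lift a (· ≤ ·) s.1 t.1) fun _ _ _ _ hs ht =>
    propext ⟨fun h => Tree.lift_congr a _ hs ht h,
      fun h => Tree.lift_congr a _ (Tree.lift_symm a _ _ hs) (Tree.lift_symm a _ _ ht) h⟩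

theorem mk_le [LE M] {α : Ordinal.{v}} {s t : Tree ι M} {hs : Tree.Stage α s}
    {ht : Tree.Stage α t} :
    mk a s hs ≤ mk a t ht ↔ Tree.Lift a (· ≤ ·) s t := Iff.rfl

/-- The embedding of a stage in a later one: the name is kept. -/
def emb [LE M] {β γ : Ordinal.{v}} (h : β ≤ γ) : StageClass a M β ↪o StageClass a M γ where
  toFun := Quotient.lift (fun t => mk a t.1 (t.2.mono h)) fun _ _ k => mk_eq.2 k
  inj' := by
    intro x y hxy
    obtain ⟨s, hs, rfl⟩ := exists_mk x
    obtain ⟨t, ht, rfl⟩ := exists_mk y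
    exact mk_eq.2 (mk_eq.1 hxy)
  map_rel_iff' := by
    intro x y
    obtain ⟨s, hs, rfl⟩ := exists_mk x
    obtain ⟨t, ht, rfl⟩ := exists_mk y
    exact Iff.rfl

theorem leaf_bijective (a : Ultrafilter ι) (M : Type w) : Function.Bijective
    (fun m : M => mk a (α := (0 : Ordinal.{v})) (.leaf m) (.leaf 0 m)) := by
  constructor
  · intro m n h
    exact mk_eq.1 h
  · intro x
    obtain ⟨t, ht, rfl⟩ := exists_mk x
    cases ht with
    | leaf _ m => exact ⟨m, rfl⟩
    | node _ β h => exact absurd h not_lt_zero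

/-- Stage `0` is `M`. -/
noncomputable def zeroIso (a : Ultrafilter ι) (M : Type w) [LE M] :
    StageClass a M (0 : Ordinal.{v}) ≃o M :=
  OrderIso.symm
    { toEquiv := Equiv.ofBijective _ (leaf_bijective a M)
      map_rel_iff' := Iff.rfl }

/-- An element of stage `β + 1`, as an element of the ultrapower of stage `β`. -/
def toGerm {β : Ordinal.{v}} : StageClass a M (Order.succ β) →
    Germ (a : Filter ι) (StageClass a M β) :=
  Quotient.lift (fun t => Germ.ofFun fun i => mk a (t.1.branch i) (t.2.branch i))
    fun s t h => by
      refine Germ.coe_eq.2 ?_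
      filter_upwards [(Tree.lift_iff a Eq s.1 t.1).1 h] with i hi using mk_eq.2 hi

theorem toGerm_bijective (β : Ordinal.{v}) :
    Function.Bijective (toGerm (a := a) (M := M) (β := β)) := by
  constructor
  · intro x y hxy
    obtain ⟨s, hs, rfl⟩ := exists_mk x
    obtain ⟨t, ht, rfl⟩ := exists_mk y
    refine mk_eq.2 ((Tree.lift_iff a Eq s t).2 ?_)
    filter_upwards [Germ.coe_eq.1 hxy] with i hi using mk_eq.1 hi
  · intro x
    induction x using Germ.inductionOn with
    | h f =>
      choose g hg hgf using fun i => exists_mk (f i)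
      exact ⟨mk a (.node g) (.node _ β (Order.lt_succ β) g hg),
        Germ.coe_eq.2 (Eventually.of_forall hgf)⟩

/-- Stage `β + 1` is the ultrapower of stage `β`. -/
noncomputable def succIso [LE M] (β : Ordinal.{v}) :
    StageClass a M (Order.succ β) ≃o Germ (a : Filter ι) (StageClass a M β) where
  toEquiv := Equiv.ofBijective _ (toGerm_bijective β)
  map_rel_iff' := by
    intro x y
    obtain ⟨s, hs, rfl⟩ := exists_mk x
    obtain ⟨t, ht, rfl⟩ := exists_mk y
    exact (Tree.lift_iff a (· ≤ ·) s t).symm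

end StageClass

/-- The direct system of the skew ultralimits of `M` with respect to `a`. -/
noncomputable def skewSystem {ι : Type} (a : Ultrafilter ι) (M : Type w) [LE M] :
    SkewSystem.{v} a M where
  Carrier := StageClass a M
  le := inferInstance
  emb := StageClass.emb
  emb_refl := by
    intro β x
    obtain ⟨t, ht, rfl⟩ := StageClass.exists_mk x
    rfl
  emb_trans := by
    intro β γ δ h₁ h₂ x
    obtain ⟨t, ht, rfl⟩ := StageClass.exists_mk x
    rfl
  zeroIso := StageClass.zeroIso a M
  succIso := StageClass.succIso
  succIso_emb_zero := by
    intro x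
    obtain ⟨m, rfl⟩ := (StageClass.leaf_bijective a M).2 x
    rfl
  succIso_emb_succ := by
    intro δ β h x
    obtain ⟨t, ht, rfl⟩ := StageClass.exists_mk x
    rfl
  exists_of_limit := by
    intro γ hγ x
    obtain ⟨t, ht, rfl⟩ := StageClass.exists_mk x
    cases ht with
    | leaf _ m => exact ⟨0, hγ.bot_lt, StageClass.mk a (.leaf m) (.leaf 0 m), rfl⟩
    | node _ β h g hg =>
      exact ⟨Order.succ β, hγ.succ_lt h,
        StageClass.mk a (.node g) (.node _ β (Order.lt_succ β) g hg), rfl⟩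

/-- The skew ultralimit `M_{a,α}` of rank `α` of `M` with respect to `a`. -/
def SkewUltralimit {ι : Type} (a : Ultrafilter ι) (M : Type w) [LE M] (α : Ordinal.{v}) :
    Type w :=
  (skewSystem a M).Carrier α

noncomputable instance {ι : Type} (a : Ultrafilter ι) (M : Type w) [LE M] (α : Ordinal.{v}) :
    LE (SkewUltralimit a M α) :=
  (skewSystem a M).le α

/-! ### Types of ultrafilters -/

/-- The Rudin–Keisler preorder on the ultrafilters on `ω`. -/
def RKLe (u v : Ultrafilter ℕ) : Prop := ∃ f : ℕ → ℕ, v.map f = u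

theorem RKLe.refl (u : Ultrafilter ℕ) : RKLe u u := ⟨id, Ultrafilter.map_id u⟩

theorem RKLe.trans {u v w : Ultrafilter ℕ} : RKLe u v → RKLe v w → RKLe u w := by
  rintro ⟨f, rfl⟩ ⟨g, rfl⟩
  exact ⟨f ∘ g, (Ultrafilter.map_map w g f).symm⟩

/-- Rudin–Keisler equivalence. -/
def rkSetoid : Setoid (Ultrafilter ℕ) where
  r u v := RKLe u v ∧ RKLe v u
  iseqv :=
    { refl := fun u => ⟨.refl u, .refl u⟩
      symm := fun h => ⟨h.2, h.1⟩
      trans := fun h k => ⟨h.1.trans k.1, k.2.trans h.2⟩ }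

/-- Types of ultrafilters on `ω`. -/
def UType : Type := Quotient rkSetoid

/-- The type `τ(u)`. -/
def tau (u : Ultrafilter ℕ) : UType := Quotient.mk rkSetoid u

/-- The Rudin–Keisler order on types. -/
instance : PartialOrder UType where
  le := Quotient.lift₂ RKLe (by
    intro u v u' v' hu hv
    exact propext ⟨fun h => hu.2.trans (h.trans hv.1), fun h => hu.1.trans (h.trans hv.2)⟩)
  le_refl := by
    rintro ⟨u⟩
    exact RKLe.refl u
  le_trans := by
    rintro ⟨u⟩ ⟨v⟩ ⟨w⟩ h k
    exact RKLe.trans h k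
  le_antisymm := by
    rintro ⟨u⟩ ⟨v⟩ h k
    exact Quotient.sound ⟨h, k⟩

/-! ### Iterated limits -/

/-- The injective functions `ω → βω` with discrete range. -/
def DF : Set (ℕ → Ultrafilter ℕ) :=
  {f | Function.Injective f ∧ DiscreteTopology (Set.range f)}

/-- `W_α(u)`: it is `ω` (the principal ultrafilters) for `α = 0`; for `α > 0` it is the set of all
`f̃(u)`, where `f ∈ DF` and `{i | f i ∈ W_{<α}(u) ∖ W_{<β}(u)} ∈ u` for all `β < α`. See `W_zero`
and `W_of_pos`. -/
def W (u : Ultrafilter ℕ) (α : Ordinal.{v}) : Set (Ultrafilter ℕ) :=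
  {x | (α = 0 ∧ x ∈ Set.range (pure : ℕ → Ultrafilter ℕ)) ∨
    (0 < α ∧ ∃ f ∈ DF, Ultrafilter.extend f u = x ∧ ∀ β, ∀ _ : β < α,
      {i : ℕ | (∃ γ, ∃ _ : γ < α, f i ∈ W u γ) ∧ ¬ ∃ γ, ∃ _ : γ < β, f i ∈ W u γ} ∈ u)}
termination_by α
decreasing_by
  · assumption
  · exact lt_trans ‹_› ‹_›

/-- `W_{<α}(u)`. -/
def WLt (u : Ultrafilter ℕ) (α : Ordinal.{v}) : Set (Ultrafilter ℕ) :=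
  ⋃ (β : Ordinal.{v}) (_ : β < α), W u β

theorem W_zero (u : Ultrafilter ℕ) :
    W u (0 : Ordinal.{v}) = Set.range (pure : ℕ → Ultrafilter ℕ) := by
  rw [W]
  ext x
  simp

theorem W_of_pos (u : Ultrafilter ℕ) {α : Ordinal.{v}} (hα : 0 < α) :
    W u α = {x | ∃ f ∈ DF, Ultrafilter.extend f u = x ∧
      ∀ β < α, {i : ℕ | f i ∈ WLt u α \ WLt u β} ∈ u} := by
  rw [W]
  ext x
  simp only [Set.mem_ofPred_eq, hα, hα.ne', false_and, true_and, false_or, WLt, Set.mem_sdiff,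
    Set.mem_iUnion]

/-- `W^τ_{<α}(u)`: the types of the members of `W_{<α}(u)`. -/
def WTauLt (u : Ultrafilter ℕ) (α : Ordinal.{v}) : Set UType := tau '' WLt u α

end SkewUL

namespace SkewUL

open Filter

/-! Summing over `u` acts on types like an ultrapower by `u`. The type of the limit of a discrete
sequence depends only on the types of `u`-almost all terms (`tau_usum_eq_tau_extend`), and two such
limits compare as their terms do, provided that corresponding terms are comparable
(`extend_rkLe_extend_iff`). The latter rests on the rigidity of ultrafilters: a map that fixes an
ultrafilter is the identity almost everywhere (`eventually_eq_self_of_map_eq`).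

The principal type plays the role of `0` and the power `u^m` that of `m`. Since `u^m` is the `u`-sum
of copies of `u^(m-1)`, summation also adds one. The class of a sequence `(x i)` must therefore
correspond to the sum of the ultrafilters for `x i - 1`; only then does a constant sequence `m` give
`u^m` again, as the diagonal embedding `e₀₁` demands. Unfolding this through the stages leads to
`value u t k`, the ultrafilter for the truncated difference `t - k`, where `k` counts the summations
already performed.

By induction on names, `value` turns the lifted order of `ℕ` into the Rudin–Keisler order
(`value_rkLe_iff`); totality of `≤` on `ℕ` supplies the comparability of terms. Finite ranks contain
only powers, up to type, and above `ω` each rank is reached by sums of named ultrafilters of smaller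
rank, so every type has a name (`exists_value`). -/

/-! ### Fixed points of maps on ultrafilters -/

/-- The parity of the number of steps during which the iteration of `h` decreases. -/
def descColor (h : ℕ → ℕ) (n : ℕ) : Bool :=
  if h n < n then !descColor h (h n) else false
termination_by n

/-- The parity of the number of steps during which the iteration of `h` increases below `N`. -/
def ascColor (h : ℕ → ℕ) (N n : ℕ) : Bool :=
  if n < h n ∧ n < N then !ascColor h N (h n) else false
termination_by N - n

/-- Invariance of `u` under `h` gives `C n` and `C (h n)` the same truth value almost everywhere. -/
theorem not_eventually_alternating {u : Ultrafilter ℕ} {h : ℕ → ℕ} (hu : u.map h = u)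
    (C : ℕ → Prop) : ¬ ∀ᶠ n in (u : Filter ℕ), (C n ↔ ¬ C (h n)) := by
  intro H
  have key : (∀ᶠ n in (u : Filter ℕ), C n) ↔ ∀ᶠ n in (u : Filter ℕ), C (h n) := by
    conv_lhs => rw [← hu]
    rfl
  by_cases hC : ∀ᶠ n in (u : Filter ℕ), C n
  · obtain ⟨n, h₁, h₂, h₃⟩ := (H.and (hC.and (key.1 hC))).exists
    exact h₁.1 h₂ h₃
  · have h₁ := Ultrafilter.eventually_not.2 hC
    have h₂ := Ultrafilter.eventually_not.2 (mt key.2 hC)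
    obtain ⟨n, h₃, h₄, h₅⟩ := (H.and (h₁.and h₂)).exists
    exact h₄ (h₃.2 h₅)

/-- Otherwise `h` decreases almost everywhere or increases almost everywhere, and in either case the
parity of a number of steps along the orbit is a 2-colouring that alternates under `h`. -/
theorem eventually_eq_self_of_map_eq {u : Ultrafilter ℕ} {h : ℕ → ℕ} (hu : u.map h = u) :
    ∀ᶠ n in (u : Filter ℕ), h n = n := by
  by_contra hne
  have hne' : ∀ᶠ n in (u : Filter ℕ), h n < n ∨ n < h n := by
    filter_upwards [Ultrafilter.eventually_not.2 hne] with n hn using lt_or_gt_of_ne hn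
  rcases Ultrafilter.eventually_or.1 hne' with hd | ha
  · refine not_eventually_alternating hu (fun n => descColor h n = true) ?_
    filter_upwards [hd] with n hn
    rw [descColor, if_pos hn]
    simp
  -- An increasing orbit need not end, so its steps are counted below a bound `N`. The parity flips
  -- from `n` to `h n` for every `N > n`, and a limit along a non-principal ultrafilter in `N`
  -- removes the bound.
  · refine not_eventually_alternating hu
      (fun n => ∀ᶠ N in (hyperfilter ℕ : Filter ℕ), ascColor h N n = true) ?_
    filter_upwards [ha] with n hn
    rw [← Ultrafilter.eventually_not]
    refine eventually_congr ?_
    have hN : ∀ᶠ N in (hyperfilter ℕ : Filter ℕ), n < N :=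
      Nat.hyperfilter_le_atTop (eventually_gt_atTop n)
    filter_upwards [hN] with N hN
    rw [ascColor, if_pos ⟨hn, hN⟩]
    simp

/-! ### Limits of sequences of ultrafilters -/

theorem extend_eq_bind (f : ℕ → Ultrafilter ℕ) (u : Ultrafilter ℕ) :
    Ultrafilter.extend f u = u.bind f := by
  rw [ultrafilter_extend_eq_iff, ultrafilter_converges_iff]
  rfl

theorem eventually_extend {f : ℕ → Ultrafilter ℕ} {u : Ultrafilter ℕ} {p : ℕ → Prop} :
    (∀ᶠ n in ((Ultrafilter.extend f u : Ultrafilter ℕ) : Filter ℕ), p n) ↔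
      ∀ᶠ i in (u : Filter ℕ), ∀ᶠ n in (f i : Filter ℕ), p n := by
  rw [extend_eq_bind]
  rfl

theorem map_extend (h : ℕ → ℕ) (f : ℕ → Ultrafilter ℕ) (u : Ultrafilter ℕ) :
    (Ultrafilter.extend f u).map h = Ultrafilter.extend (fun i => (f i).map h) u := by
  rw [extend_eq_bind, extend_eq_bind]
  rfl

theorem extend_congr {f g : ℕ → Ultrafilter ℕ} {u : Ultrafilter ℕ}
    (h : ∀ᶠ i in (u : Filter ℕ), f i = g i) : Ultrafilter.extend f u = Ultrafilter.extend g u := by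
  refine Ultrafilter.ext fun s => ?_
  change (∀ᶠ n in ((Ultrafilter.extend f u : Ultrafilter ℕ) : Filter ℕ), n ∈ s) ↔
    ∀ᶠ n in ((Ultrafilter.extend g u : Ultrafilter ℕ) : Filter ℕ), n ∈ s
  rw [eventually_extend, eventually_extend]
  refine eventually_congr ?_
  filter_upwards [h] with i hi
  rw [hi]

theorem map_congr_of_eventually {u : Ultrafilter ℕ} {g h : ℕ → ℕ}
    (H : ∀ᶠ n in (u : Filter ℕ), g n = h n) : u.map g = u.map h :=
  Ultrafilter.coe_injective (Filter.map_congr H)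

/-- A sequence of ultrafilters is injective with discrete range if and only if its members are
supported by the fibres of some map. -/
theorem mem_DF_iff {f : ℕ → Ultrafilter ℕ} :
    f ∈ DF ↔ ∃ p : ℕ → ℕ, ∀ i, ∀ᶠ n in (f i : Filter ℕ), p n = i := by
  classical
  constructor
  · rintro ⟨hinj, hdisc⟩
    have hA : ∀ i, ∃ A ∈ f i, ∀ j, A ∈ f j → j = i := by
      intro i
      obtain ⟨U, hU, hUi⟩ := isOpen_induced_iff.1
        (isOpen_discrete ({⟨f i, i, rfl⟩} : Set (Set.range f)))
      have hiU : f i ∈ U := by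
        have : (⟨f i, i, rfl⟩ : Set.range f) ∈ Subtype.val ⁻¹' U := by rw [hUi]; rfl
        exact this
      obtain ⟨_, ⟨A, rfl⟩, hAi, hAU⟩ :=
        ultrafilterBasis_is_basis.exists_subset_of_mem_open hiU hU
      refine ⟨A, hAi, fun j hj => ?_⟩
      have : (⟨f j, j, rfl⟩ : Set.range f) ∈ Subtype.val ⁻¹' U := hAU hj
      rw [hUi] at this
      exact hinj (congrArg Subtype.val this)
    choose A hA hA' using hA
    -- The sets `A i` isolate the terms but may overlap; taking the least index makes them disjoint.
    -- Only the finitely many `A j` with `j < i` are removed from `A i`, and none of them belongs to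
    -- `f i`.
    refine ⟨fun n => if h : ∃ i, n ∈ A i then Nat.find h else 0, fun i => ?_⟩
    have hlt : ∀ᶠ n in (f i : Filter ℕ), ∀ j ∈ Set.Iio i, n ∉ A j := by
      refine (Set.finite_Iio i).eventually_all.2 fun j hj => ?_
      refine Ultrafilter.eventually_not.2 fun h => ?_
      exact (ne_of_gt hj) (hA' j i h)
    filter_upwards [hlt, hA i] with n h₁ h₂
    have hex : ∃ i, n ∈ A i := ⟨i, h₂⟩
    rw [dif_pos hex, Nat.find_eq_iff]
    exact ⟨h₂, h₁⟩
  · rintro ⟨p, hp⟩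
    have hkey : ∀ i j, (∀ᶠ n in (f j : Filter ℕ), p n = i) → i = j := by
      intro i j h
      obtain ⟨n, h₁, h₂⟩ := (h.and (hp j)).exists
      exact h₁.symm.trans h₂
    refine ⟨fun i j hij => hkey i j (hij ▸ hp i), ?_⟩
    rw [discreteTopology_iff_isOpen_singleton]
    rintro ⟨_, i, rfl⟩
    refine isOpen_induced_iff.2 ⟨_, ultrafilter_isOpen_basic {n | p n = i}, ?_⟩
    ext ⟨_, j, rfl⟩
    constructor
    · intro h
      have := hkey i j h
      subst this
      rfl
    · intro h
      have : f j = f i := congrArg Subtype.val h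
      change _ ∈ f j
      rw [this]
      exact hp i

/-- The terms `g i` live on disjoint fibres of one map `p`, so the maps witnessing the termwise
reductions glue to a single map. -/
theorem extend_rkLe_extend {f g : ℕ → Ultrafilter ℕ} {u : Ultrafilter ℕ} (hg : g ∈ DF)
    (h : ∀ᶠ i in (u : Filter ℕ), RKLe (f i) (g i)) :
    ∃ k : ℕ → ℕ, (Ultrafilter.extend g u).map k = Ultrafilter.extend f u ∧
      ∀ᶠ i in (u : Filter ℕ), (g i).map k = f i := by
  classical
  obtain ⟨p, hp⟩ := mem_DF_iff.1 hg
  choose! H hH using fun i (hi : RKLe (f i) (g i)) => hi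
  have key : ∀ᶠ i in (u : Filter ℕ), (g i).map (fun n => H (p n) n) = f i := by
    filter_upwards [h] with i hi
    rw [← hH i hi]
    refine map_congr_of_eventually ?_
    filter_upwards [hp i] with n hn
    rw [hn]
  refine ⟨fun n => H (p n) n, ?_, key⟩
  rw [map_extend]
  exact extend_congr key

/-- The glued map `k` followed by the given map `l` back fixes the limit of `g`. By rigidity `l ∘ k`
is the identity almost everywhere there, hence modulo almost every `g i`, so `l` carries `f i` to `g
i`. -/
theorem rkLe_of_extend_rkLe {f g : ℕ → Ultrafilter ℕ} {u : Ultrafilter ℕ} (hg : g ∈ DF)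
    (h : ∀ᶠ i in (u : Filter ℕ), RKLe (f i) (g i))
    (hle : RKLe (Ultrafilter.extend g u) (Ultrafilter.extend f u)) :
    ∀ᶠ i in (u : Filter ℕ), RKLe (g i) (f i) := by
  obtain ⟨k, hk, hki⟩ := extend_rkLe_extend hg h
  obtain ⟨l, hl⟩ := hle
  rw [← hk, Ultrafilter.map_map] at hl
  have := eventually_extend.1 (eventually_eq_self_of_map_eq hl)
  filter_upwards [this, hki] with i h₁ h₂
  refine ⟨l, ?_⟩
  rw [← h₂, Ultrafilter.map_map]
  exact (map_congr_of_eventually h₁).trans (Ultrafilter.map_id _)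

/-- Limits of discrete sequences with comparable terms are compared termwise. -/
theorem extend_rkLe_extend_iff {f g : ℕ → Ultrafilter ℕ} {u : Ultrafilter ℕ} (hf : f ∈ DF)
    (hg : g ∈ DF) (h : ∀ᶠ i in (u : Filter ℕ), RKLe (f i) (g i) ∨ RKLe (g i) (f i)) :
    RKLe (Ultrafilter.extend f u) (Ultrafilter.extend g u) ↔
      ∀ᶠ i in (u : Filter ℕ), RKLe (f i) (g i) := by
  refine ⟨fun hle => ?_, fun h' => ?_⟩
  · rcases Ultrafilter.eventually_or.1 h with h | h
    · exact h
    · exact rkLe_of_extend_rkLe hf h hle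
  · obtain ⟨k, hk, -⟩ := extend_rkLe_extend hg h'
    exact ⟨k, hk⟩

/-! ### The sets `W_{<α}` -/

theorem WLt_mono (u : Ultrafilter ℕ) {α β : Ordinal.{v}} (h : α ≤ β) : WLt u α ⊆ WLt u β := by
  intro x hx
  simp only [WLt, Set.mem_iUnion] at hx ⊢
  obtain ⟨γ, hγ, hx⟩ := hx
  exact ⟨γ, hγ.trans_le h, hx⟩

/-- The exact-rank condition in the definition of `W` can be dropped below a bound: the least `γ`
such that almost all terms lie in `WLt u γ` satisfies it automatically. -/
theorem mem_WLt_iff {u x : Ultrafilter ℕ} {α : Ordinal.{v}} :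
    x ∈ WLt u α ↔ ∃ β < α, (∃ n : ℕ, pure n = x) ∨
      ∃ f ∈ DF, Ultrafilter.extend f u = x ∧ ∀ᶠ i in (u : Filter ℕ), f i ∈ WLt u β := by
  constructor
  · intro hx
    simp only [WLt, Set.mem_iUnion] at hx
    obtain ⟨γ, hγ, hx⟩ := hx
    refine ⟨γ, hγ, ?_⟩
    rcases eq_or_ne γ 0 with rfl | h0
    · rw [W_zero] at hx
      exact Or.inl hx
    · have hpos : 0 < γ := pos_iff_ne_zero.2 h0
      rw [W_of_pos u hpos] at hx
      obtain ⟨f, hf, hfx, hfi⟩ := hx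
      refine Or.inr ⟨f, hf, hfx, ?_⟩
      filter_upwards [hfi 0 hpos] with i hi using hi.1
  · rintro ⟨β, hβ, h | ⟨f, hf, hfx, hfi⟩⟩
    · simp only [WLt, Set.mem_iUnion]
      refine ⟨0, (zero_le (a := β)).trans_lt hβ, ?_⟩
      rw [W_zero]
      exact h
    · obtain ⟨γ, hγ, hmin⟩ := WellFounded.has_min (wellFounded_lt (α := Ordinal.{v}))
        {γ | ∀ᶠ i in (u : Filter ℕ), f i ∈ WLt u γ} ⟨β, hfi⟩
      have hγβ : γ ≤ β := not_lt.1 (hmin β hfi)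
      have hpos : 0 < γ := by
        rw [pos_iff_ne_zero]
        rintro rfl
        obtain ⟨i, hi⟩ := Eventually.exists hγ
        simp [WLt] at hi
      simp only [WLt, Set.mem_iUnion]
      refine ⟨γ, hγβ.trans_lt hβ, ?_⟩
      rw [W_of_pos u hpos]
      refine ⟨f, hf, hfx, fun δ hδ => ?_⟩
      have hn : ∀ᶠ i in (u : Filter ℕ), f i ∉ WLt u δ :=
        Ultrafilter.eventually_not.2 fun h => hmin δ h hδ
      exact Eventually.and hγ hn

/-- Needed because `usum` moves its summands into disjoint columns by `Nat.pair i`. A left inverse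
of `h` carries the separating map over to the image sequence. -/
theorem map_mem_WLt {u x : Ultrafilter ℕ} {α : Ordinal.{v}} {h : ℕ → ℕ}
    (hh : Function.Injective h) (hx : x ∈ WLt u α) : x.map h ∈ WLt u α := by
  induction α using WellFoundedLT.induction generalizing x with
  | ind α ih =>
    obtain ⟨β, hβ, ⟨n, rfl⟩ | ⟨f, hf, rfl, hfi⟩⟩ := mem_WLt_iff.1 hx
    · exact mem_WLt_iff.2 ⟨β, hβ, Or.inl ⟨h n, (Ultrafilter.map_pure h n).symm⟩⟩
    · refine mem_WLt_iff.2 ⟨β, hβ, Or.inr ⟨fun i => (f i).map h, ?_, (map_extend h f u).symm, ?_⟩⟩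
      · obtain ⟨p, hp⟩ := mem_DF_iff.1 hf
        refine mem_DF_iff.2 ⟨p ∘ Function.invFun h, fun i => ?_⟩
        change ∀ᶠ n in (f i : Filter ℕ), _
        filter_upwards [hp i] with n hn
        rw [Function.comp_apply, Function.leftInverse_invFun hh n, hn]
      · filter_upwards [hfi] with i hi using ih β hβ hi

/-! ### Sums of ultrafilters -/

/-- The sum of the ultrafilters `x i` over `u`, as an ultrafilter on `ℕ`. -/
noncomputable def usum (u : Ultrafilter ℕ) (x : ℕ → Ultrafilter ℕ) : Ultrafilter ℕ :=
  Ultrafilter.extend (fun i => (x i).map (Nat.pair i)) u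

theorem map_pair_mem_DF (x : ℕ → Ultrafilter ℕ) : (fun i => (x i).map (Nat.pair i)) ∈ DF := by
  refine mem_DF_iff.2 ⟨fun n => n.unpair.1, fun i => ?_⟩
  change ∀ᶠ n in (x i : Filter ℕ), _
  exact Eventually.of_forall fun n => by simp

theorem tau_le {x y : Ultrafilter ℕ} : tau x ≤ tau y ↔ RKLe x y := Iff.rfl

theorem tau_eq {x y : Ultrafilter ℕ} : tau x = tau y ↔ RKLe x y ∧ RKLe y x :=
  ⟨fun h => Quotient.exact h, fun h => Quotient.sound h⟩

theorem tau_map_of_injective {h : ℕ → ℕ} (hh : Function.Injective h) (x : Ultrafilter ℕ) :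
    tau (x.map h) = tau x := by
  refine tau_eq.2 ⟨⟨h, rfl⟩, Function.invFun h, ?_⟩
  rw [Ultrafilter.map_map, Function.invFun_comp hh, Ultrafilter.map_id]

theorem pair_injective (i : ℕ) : Function.Injective (Nat.pair i) := fun m n h => by
  simpa using h

theorem tau_map_pair (i : ℕ) (x : Ultrafilter ℕ) : tau (x.map (Nat.pair i)) = tau x :=
  tau_map_of_injective (pair_injective i) x

theorem map_pair_rkLe {i j : ℕ} {x y : Ultrafilter ℕ} :
    RKLe (x.map (Nat.pair i)) (y.map (Nat.pair j)) ↔ RKLe x y := by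
  rw [← tau_le, ← tau_le, tau_map_pair, tau_map_pair]

theorem usum_rkLe_iff {u : Ultrafilter ℕ} {x y : ℕ → Ultrafilter ℕ}
    (h : ∀ᶠ i in (u : Filter ℕ), RKLe (x i) (y i) ∨ RKLe (y i) (x i)) :
    RKLe (usum u x) (usum u y) ↔ ∀ᶠ i in (u : Filter ℕ), RKLe (x i) (y i) := by
  unfold usum
  rw [extend_rkLe_extend_iff (map_pair_mem_DF x) (map_pair_mem_DF y)]
  · simp only [map_pair_rkLe]
  · simpa only [map_pair_rkLe] using h

/-- A limit of a discrete sequence has the type of the sum. -/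
theorem tau_usum_eq_tau_extend {u : Ultrafilter ℕ} {x f : ℕ → Ultrafilter ℕ} (hf : f ∈ DF)
    (h : ∀ᶠ i in (u : Filter ℕ), tau (x i) = tau (f i)) :
    tau (usum u x) = tau (Ultrafilter.extend f u) := by
  have h₁ : ∀ᶠ i in (u : Filter ℕ), RKLe ((x i).map (Nat.pair i)) (f i) := by
    filter_upwards [h] with i hi
    rw [← tau_le, tau_map_pair, hi]
  have h₂ : ∀ᶠ i in (u : Filter ℕ), RKLe (f i) ((x i).map (Nat.pair i)) := by
    filter_upwards [h] with i hi
    rw [← tau_le, tau_map_pair, hi]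
  obtain ⟨k, hk, -⟩ := extend_rkLe_extend hf h₁
  obtain ⟨l, hl, -⟩ := extend_rkLe_extend (map_pair_mem_DF x) h₂
  exact tau_eq.2 ⟨⟨k, hk⟩, ⟨l, hl⟩⟩

theorem pure_rkLe (n : ℕ) (x : Ultrafilter ℕ) : RKLe (pure n) x := by
  refine ⟨fun _ => n, Ultrafilter.coe_injective ?_⟩
  exact Filter.map_const

/-- The first projection sends the sum to `u`, so if the sum were principal, `u` would be too. -/
theorem not_usum_rkLe_pure {u : Ultrafilter ℕ} (hu : ∀ n : ℕ, u ≠ pure n)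
    (x : ℕ → Ultrafilter ℕ) (n : ℕ) : ¬ RKLe (usum u x) (pure n) := by
  rintro ⟨h, hh⟩
  rw [Ultrafilter.map_pure] at hh
  have h₁ : (usum u x).map (fun n => n.unpair.1) = u := by
    rw [usum, map_extend]
    have : ∀ i, ((x i).map (Nat.pair i)).map (fun n => n.unpair.1) = pure i := by
      intro i
      rw [Ultrafilter.map_map]
      refine Ultrafilter.coe_injective ?_
      have : ((fun n : ℕ => n.unpair.1) ∘ Nat.pair i) = fun _ => i := by
        ext n
        simp
      change Filter.map _ _ = pure i
      rw [this]
      exact Filter.map_const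
    simp only [this]
    rw [extend_eq_bind]
    exact Ultrafilter.ext fun s => Iff.rfl
  rw [← hh, Ultrafilter.map_pure] at h₁
  exact hu _ h₁.symm

theorem usum_mem_WLt {u : Ultrafilter ℕ} {x : ℕ → Ultrafilter ℕ} {α β : Ordinal.{v}} (h : β < α)
    (hx : ∀ i, x i ∈ WLt u β) : usum u x ∈ WLt u α :=
  mem_WLt_iff.2 ⟨β, h, Or.inr ⟨_, map_pair_mem_DF x, rfl,
    Eventually.of_forall fun i => map_mem_WLt (pair_injective i) (hx i)⟩⟩

theorem pure_mem_WLt {u : Ultrafilter ℕ} {α : Ordinal.{v}} (h : 0 < α) (n : ℕ) :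
    pure n ∈ WLt u α :=
  mem_WLt_iff.2 ⟨0, h, Or.inl ⟨n, rfl⟩⟩

/-- The powers of an ultrafilter. -/
noncomputable def upow (u : Ultrafilter ℕ) : ℕ → Ultrafilter ℕ
  | 0 => pure 0
  | n + 1 => usum u fun _ => upow u n

theorem upow_mem_WLt (u : Ultrafilter ℕ) (n : ℕ) : upow u n ∈ WLt u ((n + 1 : ℕ) : Ordinal.{v}) := by
  induction n with
  | zero => exact pure_mem_WLt (by simp) 0
  | succ n ih => exact usum_mem_WLt (by exact_mod_cast Nat.lt_succ_self _) fun _ => ih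

theorem upow_rkLe_iff {u : Ultrafilter ℕ} (hu : ∀ n : ℕ, u ≠ pure n) (m n : ℕ) :
    RKLe (upow u m) (upow u n) ↔ m ≤ n := by
  -- Both directions go through the induction together, since `usum_rkLe_iff` needs the summands to
  -- be comparable.
  suffices H : (RKLe (upow u m) (upow u n) ↔ m ≤ n) ∧ (RKLe (upow u n) (upow u m) ↔ n ≤ m) from H.1
  induction m generalizing n with
  | zero =>
    cases n with
    | zero => exact ⟨iff_of_true (.refl _) le_rfl, iff_of_true (.refl _) le_rfl⟩
    | succ n =>
      exact ⟨iff_of_true (pure_rkLe 0 _) (Nat.zero_le _),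
        iff_of_false (not_usum_rkLe_pure hu _ 0) (Nat.not_succ_le_zero _)⟩
  | succ m ih =>
    cases n with
    | zero =>
      exact ⟨iff_of_false (not_usum_rkLe_pure hu _ 0) (Nat.not_succ_le_zero _),
        iff_of_true (pure_rkLe 0 _) (Nat.zero_le _)⟩
    | succ n =>
      have h₁ := (ih n).1
      have h₂ := (ih n).2
      rw [upow, upow, usum_rkLe_iff, usum_rkLe_iff]
      · simp [h₁, h₂]
      · simp only [h₁, h₂]
        exact Eventually.of_forall fun _ => le_total _ _
      · simp only [h₁, h₂]
        exact Eventually.of_forall fun _ => le_total _ _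

/-- Up to type, the elements of `W_{<n}` with finite `n` are powers. -/
theorem exists_upow_of_mem_WLt {u x : Ultrafilter ℕ} (n : ℕ) (hx : x ∈ WLt u (n : Ordinal.{v})) :
    ∃ m < n, tau (upow u m) = tau x := by
  induction n generalizing x with
  | zero => simp [WLt] at hx
  | succ n ih =>
    obtain ⟨β, hβ, ⟨k, rfl⟩ | ⟨f, hf, rfl, hfi⟩⟩ := mem_WLt_iff.1 hx
    · exact ⟨0, n.succ_pos, tau_eq.2 ⟨pure_rkLe _ _, pure_rkLe _ _⟩⟩
    · have hβn : β ≤ n := by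
        rw [← Order.lt_succ_iff]
        simpa using hβ
      have h₁ : ∀ᶠ i in (u : Filter ℕ), ∃ m ∈ Set.Iio n, tau (upow u m) = tau (f i) := by
        filter_upwards [hfi] with i hi using ih (WLt_mono u hβn hi)
      -- Only finitely many exponents are possible, so a single one serves almost all `i`.
      obtain ⟨m, hm, h₂⟩ := (Ultrafilter.eventually_exists_mem_iff (Set.finite_Iio n)).1 h₁
      exact ⟨m + 1, Nat.succ_lt_succ hm, tau_usum_eq_tau_extend hf h₂⟩

/-! ### Names of elements of skew ultralimits -/

namespace Tree

variable {ι : Type} {M : Type w}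

/-- A leaf is its own constant branch, so names of different depths can be descended simultaneously.
-/
theorem branch_induction {P : Tree ι M → Tree ι M → Prop}
    (leaf : ∀ m n, P (.leaf m) (.leaf n))
    (node : ∀ s t, (∀ i, P (s.branch i) (t.branch i)) → P s t) (s t : Tree ι M) : P s t := by
  induction s generalizing t with
  | node g ih => exact node _ _ fun i => ih i _
  | leaf m =>
    induction t with
    | node g ih => exact node _ _ fun i => ih i
    | leaf n => exact leaf m n

theorem lift_and (a : Ultrafilter ι) {p q r : M → M → Prop} (H : ∀ x y, p x y → q x y → r x y)
    (s t : Tree ι M) : Lift a p s t → Lift a q s t → Lift a r s t := by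
  induction s, t using branch_induction with
  | leaf m n => exact H m n
  | node s t ih =>
    rw [lift_iff a p, lift_iff a q, lift_iff a r]
    intro h₁ h₂
    filter_upwards [h₁, h₂] with i k₁ k₂ using ih i k₁ k₂

theorem lift_mono (a : Ultrafilter ι) {p r : M → M → Prop} (H : ∀ x y, p x y → r x y)
    {s t : Tree ι M} (h : Lift a p s t) : Lift a r s t :=
  lift_and a (fun x y h _ => H x y h) s t h h

/-- With `lift_and`, this is the part of Łoś's theorem that transfers pointwise arithmetic on `M` to
names. -/
theorem lift_not (a : Ultrafilter ι) (r : M → M → Prop) (s t : Tree ι M) :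
    Lift a (fun x y => ¬ r x y) s t ↔ ¬ Lift a r s t := by
  induction s, t using branch_induction with
  | leaf m n => exact Iff.rfl
  | node s t ih =>
    rw [lift_iff a r, lift_iff, ← Ultrafilter.eventually_not]
    simp only [ih]

theorem lift_swap (a : Ultrafilter ι) (r : M → M → Prop) (s t : Tree ι M) :
    Lift a (fun x y => r y x) s t ↔ Lift a r t s := by
  induction s, t using branch_induction with
  | leaf m n => exact Iff.rfl
  | node s t ih =>
    rw [lift_iff a r, lift_iff]
    simp only [ih]

/-- The property of names that a property of the elements of `M` induces. -/
def All (a : Ultrafilter ι) (p : M → Prop) : Tree ι M → Prop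
  | leaf m => p m
  | node g => ∀ᶠ i in (a : Filter ι), All a p (g i)

theorem all_iff (a : Ultrafilter ι) (p : M → Prop) (t : Tree ι M) :
    All a p t ↔ ∀ᶠ i in (a : Filter ι), All a p (t.branch i) := by
  cases t with
  | node g => rfl
  | leaf m => simp [branch]

/-- Reading a property as a relation that ignores one argument lets it be combined with relations by
`lift_and`. -/
theorem all_iff_lift (a : Ultrafilter ι) (p : M → Prop) (s t : Tree ι M) :
    All a p s ↔ Lift a (fun x _ => p x) s t := by
  induction s, t using branch_induction with
  | leaf m n => exact Iff.rfl
  | node s t ih =>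
    rw [all_iff, lift_iff]
    simp only [ih]

theorem all_iff_lift_right (a : Ultrafilter ι) (p : M → Prop) (s t : Tree ι M) :
    All a p t ↔ Lift a (fun _ y => p y) s t := by
  rw [lift_swap a (fun x _ => p x), ← all_iff_lift]

theorem all_not (a : Ultrafilter ι) (p : M → Prop) (t : Tree ι M) :
    All a (fun x => ¬ p x) t ↔ ¬ All a p t := by
  rw [all_iff_lift a _ t t, lift_not a (fun x _ => p x), ← all_iff_lift]

end Tree

/-! ### The ultrafilter with a given name -/

open SkewUL.Tree

open scoped Classical in
/-- The ultrafilter that corresponds to `t - k`, where `t` is a name. -/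
noncomputable def value (u : Ultrafilter ℕ) : Tree ℕ ℕ → ℕ → Ultrafilter ℕ
  | .leaf m, k => upow u (m - k)
  | .node g, k =>
    if ∀ᶠ i in (u : Filter ℕ), All u (· ≤ k) (g i) then pure 0
    else usum u fun i => value u (g i) (k + 1)

theorem value_of_all_le {u : Ultrafilter ℕ} {t : Tree ℕ ℕ} {k : ℕ} (h : All u (· ≤ k) t) :
    value u t k = pure 0 := by
  cases t with
  | leaf m =>
    have : m - k = 0 := Nat.sub_eq_zero_of_le h
    rw [value, this, upow]
  | node g => exact if_pos h

/-- Summation adds one and `t - k = (t - (k + 1)) + 1` when `t > k`. For a leaf this is the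
recursion of `upow`, so leaves and nodes obey the same rule. -/
theorem value_of_not_all_le {u : Ultrafilter ℕ} {t : Tree ℕ ℕ} {k : ℕ} (h : ¬ All u (· ≤ k) t) :
    value u t k = usum u fun i => value u (t.branch i) (k + 1) := by
  cases t with
  | leaf m =>
    have hm : k < m := not_le.1 h
    have : m - k = (m - (k + 1)) + 1 := by omega
    simp only [branch, value]
    rw [this, upow]
  | node g => exact if_neg h

/-- Leaves give powers, whose ranks are finite and absorbed by `ω`; each node raises the rank just
as it raises the stage. -/
theorem value_mem_WLt {u : Ultrafilter ℕ} {α : Ordinal.{v}} {t : Tree ℕ ℕ} (ht : Stage α t)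
    (k : ℕ) : value u t k ∈ WLt u (Ordinal.omega0 + α) := by
  induction ht generalizing k with
  | leaf α m =>
    refine WLt_mono u ?_ (upow_mem_WLt u (m - k))
    exact (Ordinal.natCast_lt_omega0 _).le.trans le_self_add
  | node α β h g hg ih =>
    by_cases hz : All u (· ≤ k) (.node g)
    · rw [value_of_all_le hz]
      exact pure_mem_WLt (Ordinal.omega0_pos.trans_le le_self_add) 0
    · rw [value_of_not_all_le hz]
      exact usum_mem_WLt (add_lt_add_right h _) fun i => ih i (k + 1)

/-- If one name is at most `k`, the comparison is with a principal ultrafilter. If both exceed `k`,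
the sums are compared termwise, and subtracting `k + 1` instead of `k` does not change the order. -/
theorem value_rkLe_step {u : Ultrafilter ℕ} (hu : ∀ n : ℕ, u ≠ pure n) {s t : Tree ℕ ℕ} {k : ℕ}
    (H : ∀ i, RKLe (value u (s.branch i) (k + 1)) (value u (t.branch i) (k + 1)) ↔
      Lift u (fun x y => x - (k + 1) ≤ y - (k + 1)) (s.branch i) (t.branch i))
    (H' : ∀ i, RKLe (value u (t.branch i) (k + 1)) (value u (s.branch i) (k + 1)) ↔
      Lift u (fun x y => x - (k + 1) ≤ y - (k + 1)) (t.branch i) (s.branch i)) :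
    RKLe (value u s k) (value u t k) ↔ Lift u (fun x y => x - k ≤ y - k) s t := by
  by_cases hs : All u (· ≤ k) s
  · rw [value_of_all_le hs]
    refine iff_of_true (pure_rkLe 0 _) (lift_mono u ?_ ((all_iff_lift u _ s t).1 hs))
    intro x y h
    omega
  · have hs' := (all_not u _ s).2 hs
    rw [all_iff_lift u _ s t] at hs'
    rw [value_of_not_all_le hs]
    by_cases ht : All u (· ≤ k) t
    · rw [value_of_all_le ht]
      refine iff_of_false (not_usum_rkLe_pure hu _ 0) fun h => ?_
      rw [all_iff_lift_right u _ s t] at ht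
      refine (lift_not u (fun x y => x - k ≤ y - k) s t).1 (lift_and u ?_ s t hs' ht) h
      intro x y h₁ h₂
      omega
    · have ht' := (all_not u _ t).2 ht
      rw [all_iff_lift_right u _ s t] at ht'
      rw [value_of_not_all_le ht, usum_rkLe_iff]
      · simp only [H]
        rw [← lift_iff]
        constructor
        · refine fun h => lift_and u ?_ s t
            (lift_and u (fun x y => And.intro) s t hs' ht') h
          intro x y h₁ h₂
          omega
        · refine lift_mono u ?_
          intro x y h
          omega
      -- Comparability of the summands: totality of `≤` on `ℕ`, transferred to the names of the
      -- branches.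
      · refine Eventually.of_forall fun i => ?_
        rw [H, H', or_iff_not_imp_left, ← lift_not, ← lift_swap u _ (s.branch i)]
        refine lift_mono u ?_
        intro x y h
        omega

theorem value_rkLe_iff {u : Ultrafilter ℕ} (hu : ∀ n : ℕ, u ≠ pure n) (s t : Tree ℕ ℕ) (k : ℕ) :
    RKLe (value u s k) (value u t k) ↔ Lift u (fun x y => x - k ≤ y - k) s t := by
  suffices H : (RKLe (value u s k) (value u t k) ↔ Lift u (fun x y => x - k ≤ y - k) s t) ∧
      (RKLe (value u t k) (value u s k) ↔ Lift u (fun x y => x - k ≤ y - k) t s) from H.1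
  induction s, t using branch_induction generalizing k with
  | leaf m n => exact ⟨upow_rkLe_iff hu _ _, upow_rkLe_iff hu _ _⟩
  | node s t ih =>
    exact ⟨value_rkLe_step hu (fun i => (ih i (k + 1)).1) fun i => (ih i (k + 1)).2,
      value_rkLe_step hu (fun i => (ih i (k + 1)).2) fun i => (ih i (k + 1)).1⟩

/-- The induction descends to the terms of a limit, where `k` becomes `k + 1`, so all `k` are
treated at once. The lower bound on the name prevents truncation one level up. -/
theorem exists_value {u x : Ultrafilter ℕ} {α : Ordinal.{v}}
    (hx : x ∈ WLt u (Ordinal.omega0 + α)) (k : ℕ) :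
    ∃ t, Stage α t ∧ All u (k ≤ ·) t ∧ tau (value u t k) = tau x := by
  induction α using WellFoundedLT.induction generalizing x k with
  | ind α ih =>
    have hfin : ∀ m : ℕ, tau (upow u m) = tau x →
        ∃ t, Stage α t ∧ All u (k ≤ ·) t ∧ tau (value u t k) = tau x := by
      intro m hm
      refine ⟨.leaf (m + k), .leaf α _, Nat.le_add_left k m, ?_⟩
      rw [value, Nat.add_sub_cancel, hm]
    obtain ⟨β, hβ, ⟨n, rfl⟩ | ⟨f, hf, rfl, hfi⟩⟩ := mem_WLt_iff.1 hx
    · exact hfin 0 (tau_eq.2 ⟨pure_rkLe _ _, pure_rkLe _ _⟩)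
    -- For finite `β` the limit is itself a power and a leaf names it; otherwise `β = ω + δ` with `δ
    -- < α`, and the induction hypothesis names its terms.
    · rcases lt_or_ge β Ordinal.omega0 with hlt | hge
      · obtain ⟨n, rfl⟩ := Ordinal.lt_omega0.1 hlt
        have : Ultrafilter.extend f u ∈ WLt u ((n + 1 : ℕ) : Ordinal.{v}) :=
          mem_WLt_iff.2 ⟨n, by exact_mod_cast Nat.lt_succ_self n, Or.inr ⟨f, hf, rfl, hfi⟩⟩
        obtain ⟨m, -, hm⟩ := exists_upow_of_mem_WLt (n + 1) this
        exact hfin m hm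
      · obtain ⟨δ, rfl⟩ := exists_add_of_le hge
        have hδ : δ < α := lt_of_add_lt_add_left hβ
        have hex : ∀ i, ∃ t, Stage δ t ∧ All u (k + 1 ≤ ·) t ∧
            (f i ∈ WLt u (Ordinal.omega0 + δ) → tau (value u t (k + 1)) = tau (f i)) := by
          intro i
          by_cases hi : f i ∈ WLt u (Ordinal.omega0 + δ)
          · obtain ⟨t, h₁, h₂, h₃⟩ := ih δ hδ hi (k + 1)
            exact ⟨t, h₁, h₂, fun _ => h₃⟩
          -- A default name for the negligible set of remaining indices, chosen to keep the stage
          -- and the lower bound valid at every `i`.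
          · exact ⟨.leaf (k + 1), .leaf δ _, le_refl (k + 1), fun h => absurd h hi⟩
        choose g hg hgk hgf using hex
        refine ⟨.node g, .node α δ hδ g hg, ?_, ?_⟩
        · refine (all_iff_lift u _ _ (.leaf 0)).2 (lift_mono u (fun x y => Nat.le_of_succ_le)
            ((all_iff_lift u (k + 1 ≤ ·) (.node g) (.leaf 0)).1 ?_))
          exact Eventually.of_forall hgk
        -- Every branch is at least `k + 1`, so the value is a genuine sum and not the default `pure
        -- 0`.
        · have hz : ¬ All u (· ≤ k) (.node g) := by
            rw [← all_not]
            simp only [not_le]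
            exact Eventually.of_forall hgk
          rw [value_of_not_all_le hz]
          refine tau_usum_eq_tau_extend hf ?_
          filter_upwards [hfi] with i hi using hgf i hi

/-- The type of the ultrafilter that corresponds to an element of a skew ultralimit. -/
noncomputable def stageTau {u : Ultrafilter ℕ} (hu : ∀ n : ℕ, u ≠ pure n) (α : Ordinal.{v}) :
    StageClass u ℕ α → WTauLt u (Ordinal.omega0 + α) :=
  Quotient.lift (fun t => ⟨tau (value u t.1 0), _, value_mem_WLt t.2 0, rfl⟩) fun s t h => by
    refine Subtype.ext (tau_eq.2 ⟨?_, ?_⟩)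
    · exact (value_rkLe_iff hu _ _ 0).2 (lift_mono u (fun x y h => h ▸ le_rfl) h)
    · exact (value_rkLe_iff hu _ _ 0).2
        (lift_mono u (fun x y h => h ▸ le_rfl) (lift_symm u _ _ h))

theorem stageTau_le_iff {u : Ultrafilter ℕ} (hu : ∀ n : ℕ, u ≠ pure n) {α : Ordinal.{v}}
    (x y : StageClass u ℕ α) : stageTau hu α x ≤ stageTau hu α y ↔ x ≤ y := by
  obtain ⟨s, hs, rfl⟩ := StageClass.exists_mk x
  obtain ⟨t, ht, rfl⟩ := StageClass.exists_mk y
  exact value_rkLe_iff hu s t 0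

theorem stageTau_bijective {u : Ultrafilter ℕ} (hu : ∀ n : ℕ, u ≠ pure n) (α : Ordinal.{v}) :
    Function.Bijective (stageTau hu α) := by
  constructor
  · intro x y hxy
    have h₁ := (stageTau_le_iff hu x y).1 hxy.le
    have h₂ := (stageTau_le_iff hu y x).1 hxy.ge
    obtain ⟨s, hs, rfl⟩ := StageClass.exists_mk x
    obtain ⟨t, ht, rfl⟩ := StageClass.exists_mk y
    rw [StageClass.mk_le] at h₁ h₂
    exact StageClass.mk_eq.2 (lift_and u (fun _ _ => le_antisymm) s t h₁
      ((lift_swap u (· ≤ ·) s t).2 h₂))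
  · rintro ⟨_, x, hx, rfl⟩
    obtain ⟨t, ht, -, h⟩ := exists_value hx 0
    exact ⟨StageClass.mk u t ht, Subtype.ext h⟩

end SkewUL

theorem mainTheorem2 (u : Ultrafilter ℕ) (hu : ∀ n : ℕ, u ≠ pure n) (α : Ordinal.{v}) :
    Nonempty (SkewUL.WTauLt u (Ordinal.omega0 + α) ≃o SkewUL.SkewUltralimit u ℕ α) := by
  have e : SkewUL.StageClass u ℕ α ≃o SkewUL.WTauLt u (Ordinal.omega0 + α) :=
    { toEquiv := Equiv.ofBijective _ (SkewUL.stageTau_bijective hu α)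
      map_rel_iff' := SkewUL.stageTau_le_iff hu _ _ }
  exact ⟨e.symm⟩
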